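/- Notation and definitions. Let $\mathbb{D}$ be the open unit disc, $\mathbb{T}$ the unit circle, and let $H_1^\infty$ be the space of bounded holomorphic functions $f$ on $\mathbb{D}$ with $f'(0)=0$, with the supremum norm. A set $\Psi$ of complex-valued functions on a set $X$ is a *set of test functions* if $\sup_{\psi\in\Psi}|\psi(x)|<1$ for each $x\in X$, and for every finite $F\subseteq X$ with $n$ elements the unital algebra generated by the restrictions $\psi|_F$, $\psi\in\Psi$, has dimension $n$. Let $\mathcal{K}_\Psi$ be the set of positive (semidefinite) kernels $k$ on $X$ such that $(1-\psi(x)\overline{\psi(y)})k(x,y)$ is a positive kernel for every $\psi\in\Psi$. Let $H^\infty(\mathcal{K}_\Psi)$ be the normed space of functions on $X$ whose closed unit ball is the set of those $f$ for which $(1-f(x)\overline{f(y)})k(x,y)$ is a positive kernel for every $k\in\mathcal{K}_\Psi$. A set $\Psi$ of functions on $\mathbb{D}$ is a *set of test functions for $H_1^\infty$* if it is a set of test functions and $H^\infty(\mathcal{K}_\Psi)=H_1^\infty$ with equality of norms. Let $\widehat\Theta$ be the set of Borel probability measures $\mu$ on $\mathbb{T}$ with $\int_{\mathbb{T}} w\,d\mu(w)=0$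 that are supported on at most three points, with the weak-* topology. (These correspond to the diameters of the circle and to the inscribed triangles with the centre of the circle in their interior.) For $\mu\in\widehat\Theta$ put $$h_\mu(z)=\int_{\mathbb{T}}\frac{w+z}{w-z}\,d\mu(w),\qquad \psi_\mu=\frac{h_\mu-1}{h_\mu+1}\qquad(z\in\mathbb{D}).$$ Write $\mu_1\sim\mu_2$ if $\psi_{\mu_1}=\lambda\psi_{\mu_2}$ for some constant $\lambda$ with $|\lambda|=1$, and let $\Theta=\widehat\Theta/{\sim}$ with the quotient topology. Each class in $\Theta$ contains exactly one measure $\mu$ with $\mu(\{-1\})>0$; for $\vartheta\in\Theta$ let $\psi_\vartheta$ be $\psi_\mu$ for this $\mu$. Let $\Psi=\{\psi_\vartheta:\vartheta\in\Theta\}$, with the topology carried over from $\Theta$ by the bijection $\vartheta\mapsto\psi_\vartheta$. **Theorem.** No proper closed subset $C$ of $\Psi$ is a set of test functions for $H_1^\infty$. -/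

import Mathlib

open MeasureTheory Topology
open scoped ComplexOrder ENNReal ComplexConjugate Complex.UnitDisc

namespace TestFunctions

/-! ### Test functions and the spaces they generate, on an arbitrary set `X` -/

section Abstract

variable {X : Type*}

/-- `Ψ` is a set of test functions on `X`: it is pointwise uniformly bounded by a number `< 1`,
and for each finite `F ⊆ X` with `n` elements the unital algebra generated by the restrictions
`ψ|_F`, `ψ ∈ Ψ`, is `n`-dimensional. -/
def IsTestFamily (Ψ : Set (X → ℂ)) : Prop :=
  (∀ x : X, ⨆ ψ ∈ Ψ, ‖ψ x‖ₑ < 1) ∧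
  ∀ F : Finset X,
    Module.finrank ℂ (Algebra.adjoin ℂ ((fun (ψ : X → ℂ) (x : F) => ψ x) '' Ψ)) = F.card

/-- `k` is a positive kernel on `X`: all its finite sections are positive semidefinite. -/
def IsPosKernel (k : X → X → ℂ) : Prop :=
  ∀ F : Finset X, (Matrix.of fun x y : F => k x y).PosSemidef

/-- The set `𝒦_Ψ` of the positive kernels `k` on `X` such that
`(1 - ψ(x) conj(ψ(y))) k(x, y)` is positive for each `ψ ∈ Ψ`. -/
def kernels (Ψ : Set (X → ℂ)) : Set (X → X → ℂ) :=
  {k | IsPosKernel k ∧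
    ∀ ψ ∈ Ψ, IsPosKernel fun x y => (1 - ψ x * conj (ψ y)) * k x y}

/-- The closed unit ball of `H^∞(𝒦)`: the functions `f` for which
`(1 - f(x) conj(f(y))) k(x, y)` is positive for each `k ∈ 𝒦`. -/
def unitBall (K : Set (X → X → ℂ)) : Set (X → ℂ) :=
  {f | ∀ k ∈ K, IsPosKernel fun x y => (1 - f x * conj (f y)) * k x y}

/-- The space `H^∞(𝒦)`: the positive multiples of the elements of its unit ball. -/
def HInfty (K : Set (X → X → ℂ)) : Set (X → ℂ) :=
  {f | ∃ r : ℝ, 0 < r ∧ (fun x => f x / r) ∈ unitBall K}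

/-- The norm of `H^∞(𝒦)`: the gauge of the unit ball. -/
noncomputable def HInftyNorm (K : Set (X → X → ℂ)) (f : X → ℂ) : ℝ :=
  sInf {r : ℝ | 0 < r ∧ (fun x => f x / r) ∈ unitBall K}

end Abstract

/-! ### The algebra `H_1^∞` of the unit disc -/

/-- `H_1^∞`: the bounded holomorphic functions on the unit disc with zero derivative at `0`. -/
def HOneInfty : Set (𝔻 → ℂ) :=
  {f | (∃ g : ℂ → ℂ, DifferentiableOn ℂ g (Metric.ball 0 1) ∧ deriv g 0 = 0 ∧
          ∀ z : 𝔻, f z = g z) ∧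
       ∃ M : ℝ, ∀ z : 𝔻, ‖f z‖ ≤ M}

/-- `Ψ` is a set of test functions for `H_1^∞`: it is a set of test functions on the disc, and
`H^∞(𝒦_Ψ) = H_1^∞` with equality of norms (`H_1^∞` has the supremum norm). -/
def IsTestFamilyForHOneInfty (Ψ : Set (𝔻 → ℂ)) : Prop :=
  IsTestFamily Ψ ∧ HInfty (kernels Ψ) = HOneInfty ∧
    ∀ f ∈ HOneInfty, HInftyNorm (kernels Ψ) f = ⨆ z : 𝔻, ‖f z‖

/-! ### The family `Ψ` -/

/-- The Borel σ-algebra of the unit circle. -/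
noncomputable instance : MeasurableSpace Circle := borel Circle

instance : BorelSpace Circle := ⟨rfl⟩

/-- The Borel probability measures on the unit circle with mean zero and supported on at most three
points.  One point is impossible; two points must be antipodal with weights `1/2` (a diameter);
for three points of positive weight, `0` is interior to the triangle they span and the weights are
its barycentric coordinates.  So this is the set of diameters and of triangles
inscribed in the circle with the centre in their interior.
It carries the weak-* topology. -/
abbrev ThetaHat : Type :=
  {μ : ProbabilityMeasure Circle //
    ∫ w : Circle, (w : ℂ) ∂(μ : Measure Circle) = 0 ∧
    ∃ s : Finset Circle, s.card ≤ 3 ∧ (μ : Measure Circle) ((s : Set Circle)ᶜ) = 0}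

/-- The Herglotz transform `h_μ(z) = ∫ (w + z) / (w - z) dμ(w)`. -/
noncomputable def herglotz (μ : ThetaHat) (z : 𝔻) : ℂ :=
  ∫ w : Circle, ((w : ℂ) + z) / ((w : ℂ) - z) ∂(μ.1 : Measure Circle)

/-- The function `ψ_μ = (h_μ - 1) / (h_μ + 1)`. -/
noncomputable def psi (μ : ThetaHat) (z : 𝔻) : ℂ :=
  (herglotz μ z - 1) / (herglotz μ z + 1)

/-- `μ₁ ∼ μ₂` if and only if `ψ_{μ₁}` is a unimodular constant times `ψ_{μ₂}`. -/
def thetaSetoid : Setoid ThetaHat where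
  r μ₁ μ₂ := ∃ c : ℂ, ‖c‖ = 1 ∧ ∀ z : 𝔻, psi μ₁ z = c * psi μ₂ z
  iseqv :=
    { refl := fun _ => ⟨1, by simp, by simp⟩
      symm := by
        rintro μ₁ μ₂ ⟨c, hc, h⟩
        have h0 : c ≠ 0 := by
          rintro rfl
          simp at hc
        exact ⟨c⁻¹, by simp [hc], fun z => by rw [h z, inv_mul_cancel_left₀ h0]⟩
      trans := by
        rintro μ₁ μ₂ μ₃ ⟨c, hc, h⟩ ⟨d, hd, h'⟩
        exact ⟨c * d, by simp [hc, hd], fun z => by rw [h z, h' z, mul_assoc]⟩ }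

/-- The quotient `Θ = Θ̂ / ∼`, with the quotient topology. -/
abbrev Theta : Type := Quotient thetaSetoid

/-- The family `Ψ = {ψ_ϑ : ϑ ∈ Θ}`, where each class in `Θ` is represented by its member that has a
vertex at `-1`, that is, positive mass at `-1`. -/
def Psi : Set (𝔻 → ℂ) :=
  {f | ∃ μ : ThetaHat, 0 < (μ.1 : Measure Circle) {-1} ∧ psi μ = f}

/-- The set of the `ϑ ∈ Θ` with `ψ_ϑ ∈ C`, for `C ⊆ Ψ`. -/
def params (C : Set (𝔻 → ℂ)) : Set Theta :=
  {θ | ∃ μ : ThetaHat, Quotient.mk thetaSetoid μ = θ ∧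
    0 < (μ.1 : Measure Circle) {-1} ∧ psi μ ∈ C}

/-- `C` is a closed subset of `Ψ`, where `Ψ` carries the topology of its parameter space `Θ`. -/
def IsClosedInPsi (C : Set (𝔻 → ℂ)) : Prop :=
  C ⊆ Psi ∧ IsClosed (params C)

end TestFunctions

open TestFunctions

/-! Up to a unimodular constant, `psi μ` is the Blaschke product `blaschke b` with a double zero at
`0` and third zero `b`, the sum of three points carrying `μ` (`WeightedTriple.psi_toThetaHat`). Here
`‖b‖ ≤ 1`, and all unimodular `b` give `z²` up to a constant, which is the class of the diameters.

Each such function can be isolated by a two-point Pick problem. For each `a` there are points `x ≠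
y` of the disc at which `pick`, which ignores unimodular factors, is strictly smaller for `blaschke
a` than for every inequivalent `blaschke b` (`exists_forall_pick_lt`).

Suppose `C` is closed and omits the function with parameter `a`. The parameters of `C` form a
compact set containing nothing equivalent to `a`, so there is `m` with `m²` strictly above the Pick
quotient at `a` and at most all those from `C` (`exists_pick_lt_sq_le`). The kernel on `{x, y}` with
diagonal `1` and off-diagonal entry `m` then lies in `kernels C`. If `C` were a set of test
functions for `H_1^∞`, the omitted function, which has supremum norm at most `1`, would satisfy the
Pick inequality for this kernel (`sq_le_pick_of_norm_le_one`), a contradiction. -/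

namespace TestFunctions

/-! ### Blaschke products with a double zero at the origin and the two-point Pick quotient -/

/-- The Blaschke product `z² (z - b) / (1 - conj b z)`; it degenerates to `-b z²` if `‖b‖ = 1`. -/
noncomputable def blaschke (b z : ℂ) : ℂ := z ^ 2 * (z - b) / (1 - conj b * z)

/-- The two-point Pick quotient: one minus the square of the pseudohyperbolic distance. -/
noncomputable def pick (u v : ℂ) : ℝ :=
  (1 - ‖u‖ ^ 2) * (1 - ‖v‖ ^ 2) / ‖1 - u * conj v‖ ^ 2

theorem one_sub_conj_mul_ne_zero {b z : ℂ} (hb : ‖b‖ ≤ 1) (hz : ‖z‖ < 1) :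
    1 - conj b * z ≠ 0 := by
  intro h
  have h1 : conj b * z = 1 := (sub_eq_zero.1 h).symm
  have h2 : ‖b‖ * ‖z‖ = 1 := by simpa using congrArg norm h1
  nlinarith [norm_nonneg b, norm_nonneg z]

theorem normSq_one_sub_sub_normSq_sub (b z : ℂ) :
    ‖1 - conj b * z‖ ^ 2 - ‖z - b‖ ^ 2 = (1 - ‖b‖ ^ 2) * (1 - ‖z‖ ^ 2) := by
  simp only [Complex.sq_norm, Complex.normSq_apply, Complex.sub_re, Complex.sub_im, Complex.mul_re,
    Complex.mul_im, Complex.conj_re, Complex.conj_im, Complex.one_re, Complex.one_im]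
  ring

theorem norm_blaschke_le {b z : ℂ} (hb : ‖b‖ ≤ 1) (hz : ‖z‖ < 1) : ‖blaschke b z‖ ≤ ‖z‖ ^ 2 := by
  have hd : 0 < ‖1 - conj b * z‖ := norm_pos_iff.2 (one_sub_conj_mul_ne_zero hb hz)
  have h := normSq_one_sub_sub_normSq_sub b z
  have h1 : 0 ≤ (1 - ‖b‖ ^ 2) * (1 - ‖z‖ ^ 2) :=
    mul_nonneg (by nlinarith [norm_nonneg b]) (by nlinarith [norm_nonneg z])
  have h2 : ‖z - b‖ ≤ ‖1 - conj b * z‖ := by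
    apply (pow_le_pow_iff_left₀ (norm_nonneg _) hd.le two_ne_zero).1
    linarith
  rw [blaschke, norm_div, norm_mul, norm_pow, div_le_iff₀ hd]
  gcongr

theorem norm_blaschke_lt_one {b z : ℂ} (hb : ‖b‖ ≤ 1) (hz : ‖z‖ < 1) : ‖blaschke b z‖ < 1 :=
  (norm_blaschke_le hb hz).trans_lt (by nlinarith [norm_nonneg z])

theorem norm_blaschke_lt {b z : ℂ} (hb : ‖b‖ < 1) (hz : ‖z‖ < 1) (h0 : z ≠ 0) :
    ‖blaschke b z‖ < ‖z‖ ^ 2 := by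
  have hd : 0 < ‖1 - conj b * z‖ := norm_pos_iff.2 (one_sub_conj_mul_ne_zero hb.le hz)
  have h := normSq_one_sub_sub_normSq_sub b z
  have h1 : 0 < (1 - ‖b‖ ^ 2) * (1 - ‖z‖ ^ 2) :=
    mul_pos (by nlinarith [norm_nonneg b]) (by nlinarith [norm_nonneg z])
  have h2 : ‖z - b‖ < ‖1 - conj b * z‖ := by
    apply lt_of_pow_lt_pow_left₀ 2 hd.le
    linarith
  have h3 : 0 < ‖z‖ := norm_pos_iff.2 h0
  rw [blaschke, norm_div, norm_mul, norm_pow, div_lt_iff₀ hd]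
  gcongr

theorem blaschke_of_norm_eq_one {b z : ℂ} (hb : ‖b‖ = 1) (hz : ‖z‖ < 1) :
    blaschke b z = -b * z ^ 2 := by
  have hd := one_sub_conj_mul_ne_zero hb.le hz
  have h1 : conj b * b = 1 := by rw [Complex.conj_mul', hb]; norm_num
  rw [blaschke, div_eq_iff hd]
  linear_combination z ^ 3 * (-h1)

theorem pick_le_one {u v : ℂ} (hu : ‖u‖ < 1) (hv : ‖v‖ < 1) : pick u v ≤ 1 := by
  have h := normSq_one_sub_sub_normSq_sub v u
  have hd : 0 < ‖1 - conj v * u‖ := norm_pos_iff.2 (one_sub_conj_mul_ne_zero hv.le hu)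
  rw [pick, mul_comm u, div_le_one (by positivity)]
  nlinarith [sq_nonneg ‖u - v‖]

theorem pick_nonneg {u v : ℂ} (hu : ‖u‖ < 1) (hv : ‖v‖ < 1) : 0 ≤ pick u v :=
  div_nonneg (mul_nonneg (by nlinarith [norm_nonneg u]) (by nlinarith [norm_nonneg v]))
    (by positivity)

theorem pick_mul_left {c u v : ℂ} (hc : ‖c‖ = 1) : pick (c * u) (c * v) = pick u v := by
  have h1 : c * conj c = 1 := by rw [Complex.mul_conj', hc]; norm_num
  have h2 : c * u * conj (c * v) = u * conj v := by
    rw [map_mul]; linear_combination u * conj v * h1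
  rw [pick, pick, h2, norm_mul, norm_mul, hc, one_mul, one_mul]

theorem blaschke_mul_mul {c b z : ℂ} (hc : ‖c‖ = 1) :
    blaschke (c * b) (c * z) = c ^ 3 * blaschke b z := by
  have h1 : conj c * c = 1 := by rw [Complex.conj_mul', hc]; norm_num
  have h2 : conj (c * b) * (c * z) = conj b * z := by
    rw [map_mul]; linear_combination conj b * z * h1
  rw [blaschke, blaschke, h2]
  ring

/-! ### The extremal problem for the Pick quotient at two points -/

/-- The Pick quotient of a Blaschke product at two real points. -/
theorem pick_blaschke_ofReal {b : ℂ} (hb : ‖b‖ ≤ 1) {x y : ℝ} (hx : |x| < 1) (hy : |y| < 1) :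
    pick (blaschke b x) (blaschke b y) =
      (1 - x ^ 2) * (1 - y ^ 2) / (1 - x * y) ^ 2 *
      (((b.re ^ 2 + b.im ^ 2) * x ^ 2 - 2 * b.re * x * (1 + x ^ 2) + 1 + x ^ 2 + x ^ 4) *
       ((b.re ^ 2 + b.im ^ 2) * y ^ 2 - 2 * b.re * y * (1 + y ^ 2) + 1 + y ^ 2 + y ^ 4) /
       (((b.re ^ 2 + b.im ^ 2) * (x * y) - b.re * (x + y) * (1 + x * y) + 1 + x * y
          + x ^ 2 * y ^ 2) ^ 2 + (b.im * (x - y) * (1 + x * y)) ^ 2)) := by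
  have key : ∀ t : ℝ, |t| < 1 → 1 - ‖blaschke b t‖ ^ 2 = (1 - t ^ 2) *
      ((b.re ^ 2 + b.im ^ 2) * t ^ 2 - 2 * b.re * t * (1 + t ^ 2) + 1 + t ^ 2 + t ^ 4) /
      ‖1 - conj b * t‖ ^ 2 := by
    intro t ht
    have hd : ‖1 - conj b * t‖ ≠ 0 :=
      norm_ne_zero_iff.2 (one_sub_conj_mul_ne_zero hb (by simpa using ht))
    rw [eq_div_iff (by positivity), blaschke, norm_div, div_pow, sub_mul,
      div_mul_cancel₀ _ (by positivity), norm_mul, norm_pow, Complex.norm_real, mul_pow, ← pow_mul,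
      Real.norm_eq_abs, (by norm_num : 2 * 2 = 4), Even.pow_abs (by decide : Even 4)]
    simp only [Complex.sq_norm, Complex.normSq_apply, Complex.sub_re, Complex.sub_im,
      Complex.mul_re, Complex.mul_im, Complex.conj_re, Complex.conj_im, Complex.one_re,
      Complex.one_im, Complex.ofReal_re, Complex.ofReal_im]
    ring
  have hdx := one_sub_conj_mul_ne_zero (z := x) hb (by simpa using hx)
  have hdy := one_sub_conj_mul_ne_zero (z := y) hb (by simpa using hy)
  have hdy' : 1 - b * y ≠ 0 := by
    intro h
    apply hdy
    have := congrArg conj h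
    simpa using this
  have h2 : 1 - blaschke b x * conj (blaschke b y) = ((1 - x * y : ℝ) : ℂ) *
      (((b.re ^ 2 + b.im ^ 2) * (x * y) - b.re * (x + y) * (1 + x * y) + 1 + x * y
          + x ^ 2 * y ^ 2 : ℝ) + (b.im * (x - y) * (1 + x * y) : ℝ) * Complex.I) /
      ((1 - conj b * x) * conj (1 - conj b * y)) := by
    simp only [blaschke, map_div₀, map_mul, map_sub, map_pow, Complex.conj_ofReal, map_one,
      Complex.conj_conj]
    rw [eq_div_iff (mul_ne_zero hdx hdy'), sub_mul, div_mul_div_comm,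
      div_mul_cancel₀ _ (mul_ne_zero hdx hdy')]
    apply Complex.ext <;>
    · simp only [Complex.sub_re, Complex.sub_im, Complex.add_re, Complex.add_im,
        Complex.mul_re, Complex.mul_im, Complex.conj_re, Complex.conj_im, Complex.one_re,
        Complex.one_im, Complex.ofReal_re, Complex.ofReal_im, pow_two, Complex.I_re, Complex.I_im]
      ring
  have h3 : ‖1 - blaschke b x * conj (blaschke b y)‖ ^ 2 = (1 - x * y) ^ 2 *
      (((b.re ^ 2 + b.im ^ 2) * (x * y) - b.re * (x + y) * (1 + x * y) + 1 + x * y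
          + x ^ 2 * y ^ 2) ^ 2 + (b.im * (x - y) * (1 + x * y)) ^ 2) /
      (‖1 - conj b * x‖ ^ 2 * ‖1 - conj b * y‖ ^ 2) := by
    rw [h2, norm_div, norm_mul, norm_mul, div_pow, mul_pow, mul_pow, RCLike.norm_conj]
    congr 2
    · rw [Complex.norm_real, Real.norm_eq_abs, sq_abs]
    · rw [Complex.sq_norm, Complex.normSq_add_mul_I]
  rw [pick, key x hx, key y hy, h3]
  have := norm_ne_zero_iff.2 hdx
  have := norm_ne_zero_iff.2 hdy
  rw [div_mul_div_comm, div_div_div_cancel_right₀ (by positivity), div_mul_div_comm]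
  ring

/-- With `b = p + qi`, the right side can vanish only at `b = a`. If `1 - |b|²` is at least half of
`1 - a²`, the first term suffices. Otherwise `|b|² - a²` is at least that half, and the square
suffices because `|b - a|² ≤ 4`. -/
theorem quartic_pos {a p q : ℝ} (ha0 : 0 ≤ a) (ha1 : a < 1) (hs : p ^ 2 + q ^ 2 ≤ 1)
    (hne : 0 < (p - a) ^ 2 + q ^ 2) :
    ((p - a) ^ 2 + q ^ 2) * (1 - a ^ 2) ^ 2 / 16 ≤
      2 * ((p - a) ^ 2 + q ^ 2) * (1 - (p ^ 2 + q ^ 2)) + (p ^ 2 + q ^ 2 - a ^ 2) ^ 2 := by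
  have hu4 : (p - a) ^ 2 + q ^ 2 ≤ 4 := by nlinarith [sq_nonneg (p + a), sq_nonneg q]
  set u := (p - a) ^ 2 + q ^ 2
  set s := p ^ 2 + q ^ 2
  have hr : 0 < 1 - a ^ 2 := by nlinarith
  have hr1 : 1 - a ^ 2 ≤ 1 := by nlinarith
  set r := 1 - a ^ 2 with hrdef
  have hsr : s - a ^ 2 = r - (1 - s) := by rw [hrdef]; ring
  rw [hsr]
  have hrr : r ^ 2 ≤ r := by nlinarith
  rcases le_total (r / 2) (1 - s) with h | h
  · have h1 : u * (r / 2) ≤ u * (1 - s) := by gcongr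
    have h2 : u * r ^ 2 ≤ u * r := by gcongr
    nlinarith [sq_nonneg (r - (1 - s)), mul_nonneg hne.le (sq_nonneg r)]
  · have h1 : r / 2 ≤ r - (1 - s) := by linarith
    have h2 : (r / 2) ^ 2 ≤ (r - (1 - s)) ^ 2 := by gcongr
    have h3 : u * r ^ 2 ≤ 4 * r ^ 2 := by gcongr
    have h4 : 0 ≤ 2 * u * (1 - s) := by
      have : 0 ≤ 1 - s := by linarith
      positivity
    nlinarith

/-- This is the cross-multiplied comparison of the Pick quotients at `b = p + qi` and at `a`, in the
coordinates of `exists_real_forall_pick_lt`. The relation `h` turns it into a large multiple of the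
quantity in `quartic_pos` minus a small error; `32 < κ` makes the main term win. -/
theorem pick_polynomial_pos {a p q E κ : ℝ} (ha0 : 0 ≤ a) (ha1 : a < 1) (hE : 2 ≤ E) (hκ : 32 < κ)
    (h : (κ - 1 - a ^ 2) * (E - 2) = 4 * a ^ 2) (hs : p ^ 2 + q ^ 2 ≤ 1)
    (hne : 0 < (p - a) ^ 2 + q ^ 2) :
    0 < ((κ + E + ((p - a) ^ 2 + q ^ 2)) ^ 2 - 4 * (κ + E + 1) * (p - a) ^ 2) * κ ^ 2
      - (κ + E) ^ 2 * (((p - a) ^ 2 + q ^ 2 - κ) ^ 2 + q ^ 2 * (4 * κ - 4)) := by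
  have h1a : 0 < 1 - a ^ 2 := by nlinarith
  have hM := quartic_pos ha0 ha1 hs hne
  have hid : ((κ + E + ((p - a) ^ 2 + q ^ 2)) ^ 2 - 4 * (κ + E + 1) * (p - a) ^ 2) * κ ^ 2
      - (κ + E) ^ 2 * (((p - a) ^ 2 + q ^ 2 - κ) ^ 2 + q ^ 2 * (4 * κ - 4)) =
      E * (2 * κ + E) *
        (2 * ((p - a) ^ 2 + q ^ 2) * (1 - (p ^ 2 + q ^ 2)) + (p ^ 2 + q ^ 2 - a ^ 2) ^ 2)
      - 2 * (1 - a ^ 2) ^ 2 * (E + 2) * ((p - a) ^ 2 - q ^ 2) := by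
    linear_combination 2 * (κ + E + 1 - a ^ 2) * ((p - a) ^ 2 - q ^ 2) * h
  rw [hid]
  set u := (p - a) ^ 2 + q ^ 2
  have hr : 0 < (1 - a ^ 2) ^ 2 := by
    positivity
  set r := (1 - a ^ 2) ^ 2
  have h1 : 32 * (E + 2) < E * (2 * κ + E) := by
    have h5 : E * 32 < E * κ := by gcongr
    have h6 : 2 * 2 ≤ E * E := by gcongr
    linarith
  have h2 : E * (2 * κ + E) * (u * r / 16) ≤ E * (2 * κ + E) *
        (2 * u * (1 - (p ^ 2 + q ^ 2)) + (p ^ 2 + q ^ 2 - a ^ 2) ^ 2) := by gcongr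
  have h3 : 2 * r * (E + 2) * ((p - a) ^ 2 - q ^ 2) ≤ 2 * r * (E + 2) * u := by
    gcongr
    simp only [u]; linarith [sq_nonneg q]
  have h4 : 32 * (E + 2) * (u * r / 16) < E * (2 * κ + E) * (u * r / 16) := by gcongr
  linarith

theorem exists_sq_add_one_eq_mul {X : ℝ} (hX : 2 < X) : ∃ x : ℝ, 0 < x ∧ x < 1 ∧ x ^ 2 + 1 = X * x := by
  have h : 0 ≤ X ^ 2 - 4 := by nlinarith
  have h1 := Real.sq_sqrt h
  have h2 := Real.sqrt_nonneg (X ^ 2 - 4)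
  refine ⟨(X - √(X ^ 2 - 4)) / 2, ?_, ?_, ?_⟩ <;> nlinarith

/-- A Blaschke product `blaschke a` with `0 ≤ a < 1` is the unique one with maximal
pseudohyperbolic distance between the values at two suitable real points. -/
theorem exists_real_forall_pick_lt {a : ℝ} (ha0 : 0 ≤ a) (ha1 : a < 1) :
    ∃ x y : ℝ, |x| < 1 ∧ |y| < 1 ∧ x ≠ y ∧ ∀ b : ℂ, ‖b‖ ≤ 1 → b ≠ a →
      pick (blaschke a x) (blaschke a y) < pick (blaschke b x) (blaschke b y) := by
  -- In the coordinate `t + 1/t` the two points are `a + 10` and `a - 10`. This symmetry about `a`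
  -- makes the Pick quotient even in `b.re - a`. The value `10` only has to be large enough for `32
  -- < κ` below.
  obtain ⟨x, hx0, hx1, hx⟩ := exists_sq_add_one_eq_mul (X := 10 + a) (by linarith)
  obtain ⟨y', hy0, hy1, hy'⟩ := exists_sq_add_one_eq_mul (X := 10 - a) (by linarith)
  obtain ⟨y, rfl⟩ : ∃ y, y' = -y := ⟨-y', by ring⟩
  have hy : y ^ 2 + 1 = (a - 10) * y := by linear_combination hy'
  have hax : |x| < 1 := abs_lt.2 ⟨by linarith, hx1⟩
  have hay : |y| < 1 := abs_lt.2 ⟨by linarith, by linarith⟩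
  refine ⟨x, y, hax, hay, by linarith, fun b hb hba => ?_⟩
  have hw : x * y < 0 := mul_neg_of_pos_of_neg hx0 (by linarith)
  have hw1 : -1 < x * y := by nlinarith
  -- `κ` and `E` are, up to sign and shift, `xy + 1/(xy)` and `x/y + y/x`. After division by `(xy)²`
  -- the quotient depends on `x`, `y` only through them, apart from a positive prefactor independent
  -- of `b`; also `κ + E = 10² - 1`.
  obtain ⟨κ, hκ⟩ : ∃ κ : ℝ, 1 + (x * y) ^ 2 = (x * y) * (a ^ 2 - 1 - κ) :=
    ⟨a ^ 2 - 1 - (1 + (x * y) ^ 2) / (x * y), by rw [sub_sub_cancel, mul_div_cancel₀ _ hw.ne]⟩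
  obtain ⟨E, hE⟩ : ∃ E : ℝ, x ^ 2 + y ^ 2 = (x * y) * -E :=
    ⟨-((x ^ 2 + y ^ 2) / (x * y)), by rw [neg_neg, mul_div_cancel₀ _ hw.ne]⟩
  have hN : κ + E = 99 := by
    apply mul_left_cancel₀ hw.ne
    linear_combination hκ + hE - (y ^ 2 + 1) * hx - (10 + a) * x * hy
  have hE2 : 2 ≤ E := by
    by_contra! h
    have := mul_lt_mul_of_neg_left h hw
    linarith [sq_nonneg (x + y), add_sq x y]
  have hsum : (x + y) * (1 + x * y) = 2 * a * (x * y) := by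
    linear_combination x * hy + y * hx
  -- This is the square of `hsum`, with `(x + y)²` and `(1 + xy)²` expressed through `E` and `κ`.
  have hrel : (κ - 1 - a ^ 2) * (E - 2) = 4 * a ^ 2 := by
    apply mul_left_cancel₀ (pow_ne_zero 2 hw.ne)
    linear_combination (x * y) * (E - 2) * hκ - (1 + x * y) ^ 2 * hE
      + ((x + y) * (1 + x * y) + 2 * a * (x * y)) * hsum
  have hκ32 : 32 < κ := by
    have hx9 : x < 1 / 9 := by nlinarith
    have hy8 : -y < 1 / 8 := by nlinarith
    have hxy : x * -y < 1 / 9 * (1 / 8) := by gcongr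
    have h1 : (x * y) * a ^ 2 ≤ 0 := mul_nonpos_of_nonpos_of_nonneg hw.le (sq_nonneg a)
    by_contra! h
    have h2 := mul_le_mul_of_nonpos_left h hw.le
    linarith [sq_nonneg (x * y)]
  have hdiff : ((x - y) * (1 + x * y)) ^ 2 = (x * y) ^ 2 * (4 * κ - 4) := by
    linear_combination ((x + y) * (1 + x * y) + 2 * a * (x * y)) * hsum - 4 * (x * y) * hκ
  have hdiag : ∀ (t X p q : ℝ), t ^ 2 + 1 = X * t →
      (p ^ 2 + q ^ 2) * t ^ 2 - 2 * p * t * (1 + t ^ 2) + 1 + t ^ 2 + t ^ 4 =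
        t ^ 2 * ((X - p) ^ 2 - 1 + q ^ 2) := by
    intro t X p q h
    linear_combination (t ^ 2 + 1 + X * t - 2 * p * t) * h
  have hform : ∀ b : ℂ, ‖b‖ ≤ 1 → pick (blaschke b x) (blaschke b y) =
      (1 - x ^ 2) * (1 - y ^ 2) / (1 - x * y) ^ 2 *
      (((κ + E + ((b.re - a) ^ 2 + b.im ^ 2)) ^ 2 - 4 * (κ + E + 1) * (b.re - a) ^ 2) /
        (((b.re - a) ^ 2 + b.im ^ 2 - κ) ^ 2 + b.im ^ 2 * (4 * κ - 4))) := by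
    intro b hb
    rw [pick_blaschke_ofReal hb hax hay, hdiag x _ _ _ hx, hdiag y _ _ _ hy, hN]
    congr 1
    rw [eq_comm, ← mul_div_mul_left _ _ (pow_ne_zero 2 hw.ne), eq_comm]
    congr 1
    · ring
    · linear_combination b.im ^ 2 * hdiff + ((b.re ^ 2 + b.im ^ 2) * (x * y)
        - b.re * (x + y) * (1 + x * y) + 1 + x * y + x ^ 2 * y ^ 2
        + (x * y) * ((b.re - a) ^ 2 + b.im ^ 2 - κ)) * (hκ - b.re * hsum)
  have hc : 0 < (1 - x ^ 2) * (1 - y ^ 2) / (1 - x * y) ^ 2 := by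
    have h1 : 0 < 1 - x ^ 2 := sub_pos.2 ((sq_lt_one_iff_abs_lt_one x).2 hax)
    have h2 : 0 < 1 - y ^ 2 := sub_pos.2 ((sq_lt_one_iff_abs_lt_one y).2 hay)
    have h3 : 0 < 1 - x * y := by linarith
    positivity
  rw [hform b hb, hform a (by simpa [abs_of_nonneg ha0] using ha1.le)]
  have hs : b.re ^ 2 + b.im ^ 2 ≤ 1 := by
    have := Complex.sq_norm b
    rw [Complex.normSq_apply] at this
    linarith [pow_le_one₀ (n := 2) (norm_nonneg b) hb]
  have hne : 0 < (b.re - a) ^ 2 + b.im ^ 2 := by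
    rcases eq_or_ne b.im 0 with h | h
    · have : b.re - a ≠ 0 := by
        intro h'
        exact hba (Complex.ext (by simpa using sub_eq_zero.1 h') (by simpa using h))
      positivity
    · positivity
  have hp := pick_polynomial_pos ha0 ha1 hE2 hκ32 hrel hs hne
  apply mul_lt_mul_of_pos_left _ hc
  simp only [Complex.ofReal_re, Complex.ofReal_im, sub_self]
  have hκ2 : 0 < κ ^ 2 := by positivity
  rw [div_lt_div_iff₀ (by linarith) _]
  · linarith
  · have h1 : 0 ≤ b.im ^ 2 * (4 * κ - 4) := mul_nonneg (sq_nonneg _) (by linarith)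
    have h2 : (b.re - a) ^ 2 + b.im ^ 2 ≤ 4 := by
      have : a ^ 2 ≤ 1 := pow_le_one₀ ha0 ha1.le
      linarith [sq_nonneg (b.re + a), sub_sq b.re a, add_sq b.re a, sq_nonneg b.im]
    have h3 : (b.re - a) ^ 2 + b.im ^ 2 - κ ≠ 0 := by linarith
    positivity

/-- Every `blaschke a`, `‖a‖ ≤ 1`, is the unique one, up to a unimodular factor, with maximal
pseudohyperbolic distance between the values at two suitable points of the disc. -/
theorem exists_forall_pick_lt {a : ℂ} (ha : ‖a‖ ≤ 1) :
    ∃ x y : ℂ, ‖x‖ < 1 ∧ ‖y‖ < 1 ∧ x ≠ y ∧ ∀ b : ℂ, ‖b‖ ≤ 1 → b ≠ a → (‖b‖ < 1 ∨ ‖a‖ < 1) →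
      pick (blaschke a x) (blaschke a y) < pick (blaschke b x) (blaschke b y) := by
  rcases ha.lt_or_eq with ha | ha
  · obtain ⟨c, hc, hca⟩ : ∃ c : ℂ, ‖c‖ = 1 ∧ a = c * (‖a‖ : ℂ) := by
      rcases eq_or_ne a 0 with rfl | h
      · exact ⟨1, by simp, by simp⟩
      · have h' : (‖a‖ : ℂ) ≠ 0 := by simpa using h
        exact ⟨a / ‖a‖, by simp [h], by field_simp⟩
    obtain ⟨x, y, hx, hy, hxy, h⟩ := exists_real_forall_pick_lt (norm_nonneg a) ha
    have hc0 : c ≠ 0 := norm_ne_zero_iff.1 (by rw [hc]; exact one_ne_zero)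
    have hrot : ∀ b : ℂ, pick (blaschke (c * b) (c * x)) (blaschke (c * b) (c * y)) =
        pick (blaschke b x) (blaschke b y) := fun b => by
      rw [blaschke_mul_mul hc, blaschke_mul_mul hc, pick_mul_left (by rw [norm_pow, hc, one_pow])]
    refine ⟨c * x, c * y, by simpa [hc] using hx, by simpa [hc] using hy, ?_, fun b hb hba _ => ?_⟩
    · simpa [hc0] using hxy
    · have hb' : b = c * (c⁻¹ * b) := by rw [mul_inv_cancel_left₀ hc0]
      rw [hb', hca, hrot, hrot]
      apply h
      · simpa [hc] using hb
      · rintro h'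
        exact hba (by rw [hb', h', ← hca])
  -- For unimodular `a` the function is `-a z²`. With one point at `0` the quotient is `1 -
  -- ‖blaschke b (1/2)‖²`, and the strict Schwarz-type bound decides.
  · refine ⟨0, 1 / 2, by simp, by norm_num, by norm_num, fun b hb _ h => ?_⟩
    have hb1 : ‖b‖ < 1 := h.resolve_right ha.not_lt
    have h1 := norm_blaschke_lt (z := 1 / 2) hb1 (by norm_num) (by norm_num)
    have h2 : ‖blaschke a (1 / 2)‖ = ‖(1 / 2 : ℂ)‖ ^ 2 := by
      rw [blaschke_of_norm_eq_one ha (by norm_num), norm_mul, norm_neg, ha, one_mul, norm_pow]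
    have h3 : ∀ d : ℂ, pick (blaschke d 0) (blaschke d (1 / 2)) = 1 - ‖blaschke d (1 / 2)‖ ^ 2 := by
      intro d
      simp [pick, blaschke]
    rw [h3, h3]
    have h4 : ‖blaschke b (1 / 2)‖ ^ 2 < ‖blaschke a (1 / 2)‖ ^ 2 := by
      rw [h2]
      gcongr
    linarith

/-! ### Kernels supported on two points -/

section Kernels

variable {X : Type*}

theorem IsPosKernel.add {k l : X → X → ℂ} (hk : IsPosKernel k) (hl : IsPosKernel l) :
    IsPosKernel fun x y => k x y + l x y :=
  fun F => (hk F).add (hl F)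

theorem IsPosKernel.const_mul {k : X → X → ℂ} (hk : IsPosKernel k) {r : ℝ} (hr : 0 ≤ r) :
    IsPosKernel fun x y => (r : ℂ) * k x y :=
  fun F => (hk F).smul (show (0 : ℂ) ≤ r by exact_mod_cast hr)

theorem isPosKernel_mul_conj (g : X → ℂ) : IsPosKernel fun x y => g x * conj (g y) :=
  fun F => Matrix.posSemidef_vecMulVec_self_star fun x : F => g x

open Classical in
/-- The kernel supported on `{x, y}` with diagonal entries `A`, `C` and off-diagonal entry `B`. -/
noncomputable def pairKernel (x y : X) (A C : ℝ) (B : ℂ) (z w : X) : ℂ :=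
  (if z = x then (if w = x then (A : ℂ) else if w = y then B else 0)
    else if z = y then (if w = x then conj B else if w = y then (C : ℂ) else 0) else 0)

/-- Completing the square: the kernel is a rank-one kernel plus the Schur complement `C - ‖B‖² / A`
at `y`. -/
theorem isPosKernel_pairKernel {x y : X} (hxy : x ≠ y) {A C : ℝ} {B : ℂ} (hA : 0 < A)
    (h : ‖B‖ ^ 2 ≤ A * C) : IsPosKernel (pairKernel x y A C B) := by
  classical
  have h1 := (isPosKernel_mul_conj fun z : X =>
    if z = x then 1 else if z = y then conj B / A else 0).const_mul hA.le
  have h2 := (isPosKernel_mul_conj fun z : X => if z = y then (1 : ℂ) else 0).const_mul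
    (r := C - ‖B‖ ^ 2 / A) (by rw [sub_nonneg, div_le_iff₀ hA]; linarith)
  convert h1.add h2 using 1
  have hA' : (A : ℂ) ≠ 0 := by exact_mod_cast hA.ne'
  funext z w
  rcases eq_or_ne z x with rfl | hzx
  · rcases eq_or_ne w z with rfl | hwz
    · simp [pairKernel, hxy]
    · rcases eq_or_ne w y with rfl | hwy
      · simp [pairKernel, hxy, hxy.symm]
        field_simp
      · simp [pairKernel, *]
  · rcases eq_or_ne z y with rfl | hzy
    · rcases eq_or_ne w x with rfl | hwz
      · simp [pairKernel, hxy, hxy.symm]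
        field_simp
      · rcases eq_or_ne w z with rfl | hwy
        · simp [pairKernel, hzx]
          rw [← Complex.conj_mul']
          field_simp
          ring
        · simp [pairKernel, *]
    · simp [pairKernel, *]

theorem norm_sq_le_of_isPosKernel {k : X → X → ℂ} {x y : X} {A C : ℝ}
    (hk : IsPosKernel k) (hx : k x x = A) (hy : k y y = C) : ‖k x y‖ ^ 2 ≤ A * C := by
  classical
  have h := ((hk {x, y}).submatrix
    ![(⟨x, by simp⟩ : ({x, y} : Finset X)), ⟨y, by simp⟩])
  have hd := h.det_nonneg
  have hh := h.isHermitian.apply 0 1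
  simp only [Matrix.submatrix_apply, Matrix.of_apply, Matrix.det_fin_two, Matrix.cons_val_zero,
    Matrix.cons_val_one, hx, hy] at hd hh
  rw [← hh, mul_comm (star _), ← starRingEnd_apply, Complex.mul_conj'] at hd
  have h0 : (0 : ℂ) ≤ ((A * C - ‖k y x‖ ^ 2 : ℝ) : ℂ) := by
    push_cast
    exact hd
  rw [← hh, norm_star]
  exact sub_nonneg.1 (Complex.zero_le_real.1 h0)

theorem one_sub_mul_pairKernel (f : X → ℂ) (x y : X) (m : ℝ) :
    (fun z w => (1 - f z * conj (f w)) * pairKernel x y 1 1 m z w) =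
      pairKernel x y (1 - ‖f x‖ ^ 2) (1 - ‖f y‖ ^ 2) ((1 - f x * conj (f y)) * m) := by
  funext z w
  simp only [pairKernel]
  split_ifs <;> simp_all [Complex.mul_conj']
  left; ring

theorem sq_le_pick_iff {u v : ℂ} (hu : ‖u‖ < 1) (hv : ‖v‖ < 1) (m : ℝ) :
    ‖(1 - u * conj v) * m‖ ^ 2 ≤ (1 - ‖u‖ ^ 2) * (1 - ‖v‖ ^ 2) ↔ m ^ 2 ≤ pick u v := by
  have hd : 0 < ‖1 - u * conj v‖ ^ 2 := by
    rw [mul_comm]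
    have := norm_pos_iff.2 (one_sub_conj_mul_ne_zero hv.le hu)
    positivity
  rw [pick, le_div_iff₀ hd, norm_mul, mul_pow, Complex.norm_real, Real.norm_eq_abs, sq_abs,
    mul_comm]

theorem pairKernel_mem_kernels {Ψ : Set (X → ℂ)} {x y : X} (hxy : x ≠ y) {m : ℝ} (hm : m ^ 2 ≤ 1)
    (h : ∀ ψ ∈ Ψ, ‖ψ x‖ < 1 ∧ ‖ψ y‖ < 1 ∧ m ^ 2 ≤ pick (ψ x) (ψ y)) :
    pairKernel x y 1 1 m ∈ kernels Ψ := by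
  refine ⟨isPosKernel_pairKernel hxy one_pos (by simpa using hm), fun ψ hψ => ?_⟩
  obtain ⟨hx, hy, hp⟩ := h ψ hψ
  rw [one_sub_mul_pairKernel]
  exact isPosKernel_pairKernel hxy (by nlinarith [norm_nonneg (ψ x)]) ((sq_le_pick_iff hx hy m).2 hp)

/-- With `t = r² / r'²`, the kernel for `r'` is `t` times the kernel for `r` plus `(1 - t) k`. -/
theorem div_mem_unitBall_mono {K : Set (X → X → ℂ)} (hK : ∀ k ∈ K, IsPosKernel k) {f : X → ℂ}
    {r r' : ℝ} (hr : 0 < r) (hrr : r ≤ r') (h : (fun x => f x / r) ∈ unitBall K) :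
    (fun x => f x / r') ∈ unitBall K := by
  intro k hk
  have hr' : 0 < r' := hr.trans_le hrr
  have h1 := (h k hk).const_mul (r := r ^ 2 / r' ^ 2) (by positivity)
  have h2 := (hK k hk).const_mul (r := 1 - r ^ 2 / r' ^ 2)
    (by rw [sub_nonneg, div_le_one (by positivity)]; gcongr)
  convert h1.add h2 using 1
  funext x y
  have : (r : ℂ) ≠ 0 := by exact_mod_cast hr.ne'
  have : (r' : ℂ) ≠ 0 := by exact_mod_cast hr'.ne'
  simp only [map_div₀, Complex.conj_ofReal]
  push_cast
  field_simp
  ring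

/-- The Pick condition at two points for a function of `H^∞(𝒦_Ψ)`-norm at most one. -/
theorem sq_le_pick_of_norm_le_one {Ψ : Set (X → ℂ)} {x y : X} (hxy : x ≠ y) {m : ℝ} (hm : m ^ 2 ≤ 1)
    (h : ∀ ψ ∈ Ψ, ‖ψ x‖ < 1 ∧ ‖ψ y‖ < 1 ∧ m ^ 2 ≤ pick (ψ x) (ψ y)) {f : X → ℂ}
    (hf : f ∈ HInfty (kernels Ψ)) (hf1 : HInftyNorm (kernels Ψ) f ≤ 1) (hx : ‖f x‖ < 1)
    (hy : ‖f y‖ < 1) : m ^ 2 ≤ pick (f x) (f y) := by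
  have hk := pairKernel_mem_kernels hxy hm h
  rw [← sq_le_pick_iff hx hy]
  -- The norm is an infimum that need not be attained, so the inequality is proved for `f / r` with
  -- `r > 1`, and then `r` tends to `1`.
  have hlim : ∀ r : ℝ, 1 < r → ‖(1 - f x / r * conj (f y / r)) * m‖ ^ 2 ≤
      (1 - ‖f x / r‖ ^ 2) * (1 - ‖f y / r‖ ^ 2) := by
    intro r hr
    obtain ⟨s, ⟨hs0, hs⟩, hsr⟩ := exists_lt_of_csInf_lt hf (hf1.trans_lt hr)
    have hr' := div_mem_unitBall_mono (fun k hk => hk.1) hs0 hsr.le hs _ hk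
    rw [one_sub_mul_pairKernel] at hr'
    simpa [pairKernel, hxy, hxy.symm] using norm_sq_le_of_isPosKernel hr' (x := x) (y := y)
      (A := 1 - ‖f x / r‖ ^ 2) (C := 1 - ‖f y / r‖ ^ 2)
      (by simp [pairKernel]) (by simp [pairKernel, hxy.symm])
  have hc : ContinuousAt (fun r : ℝ => (1 - ‖f x / r‖ ^ 2) * (1 - ‖f y / r‖ ^ 2) -
      ‖(1 - f x / r * conj (f y / r)) * m‖ ^ 2) 1 := by
    have h1 : ((1 : ℝ) : ℂ) ≠ 0 := by simp
    have h2 : ∀ c : ℂ, ContinuousAt (fun r : ℝ => c / r) 1 := fun c =>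
      continuousAt_const.div Complex.continuous_ofReal.continuousAt h1
    have h3 : ContinuousAt (fun r : ℝ => conj (f y / (r : ℂ))) 1 :=
      Complex.continuous_conj.continuousAt.comp (h2 (f y))
    exact ((continuousAt_const.sub ((h2 _).norm.pow 2)).mul
      (continuousAt_const.sub ((h2 _).norm.pow 2))).sub
      (((continuousAt_const.sub ((h2 _).mul h3)).mul continuousAt_const).norm.pow 2)
  have h0 := ge_of_tendsto (hc.tendsto.mono_left (nhdsWithin_le_nhds (s := Set.Ioi 1)))
    (b := 0) (by filter_upwards [self_mem_nhdsWithin] with r hr using sub_nonneg.2 (hlim r hr))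
  simpa using h0

end Kernels

/-! ### Parametrization of the measures by triples of points and weights -/

/-- The triples of points of the circle with weights for which the weighted mean is `0`. -/
def WeightedTriple : Type :=
  {p : (Fin 3 → Circle) × (Fin 3 → ℝ) // p.2 ∈ stdSimplex ℝ (Fin 3) ∧ ∑ i, (p.2 i : ℂ) * p.1 i = 0}

namespace WeightedTriple

noncomputable instance : TopologicalSpace WeightedTriple := instTopologicalSpaceSubtype

instance : CompactSpace WeightedTriple := by
  apply isCompact_iff_compactSpace.1
  have h1 : IsCompact (Set.univ ×ˢ stdSimplex ℝ (Fin 3) : Set ((Fin 3 → Circle) × (Fin 3 → ℝ))) :=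
    isCompact_univ.prod (isCompact_stdSimplex ℝ (Fin 3))
  have h2 : IsClosed {p : (Fin 3 → Circle) × (Fin 3 → ℝ) | ∑ i, (p.2 i : ℂ) * p.1 i = 0} :=
    isClosed_eq (by fun_prop) continuous_const
  have h3 := h1.inter_right h2
  rw [Set.univ_prod] at h3
  exact h3

/-- The point masses of a weighted triple. -/
noncomputable def measure (p : WeightedTriple) : Measure Circle :=
  ∑ i, ENNReal.ofReal (p.1.2 i) • Measure.dirac (p.1.1 i)

instance (p : WeightedTriple) : IsProbabilityMeasure p.measure := by
  constructor
  have h := p.2.1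
  simp only [measure, Measure.coe_finsetSum, Finset.sum_apply, Measure.smul_apply, measure_univ,
    smul_eq_mul, mul_one]
  rw [← ENNReal.ofReal_sum_of_nonneg fun i _ => h.1 i, h.2, ENNReal.ofReal_one]

theorem integral_measure {E : Type*} [NormedAddCommGroup E] [NormedSpace ℝ E] [CompleteSpace E]
    (p : WeightedTriple) (f : Circle → E) :
    ∫ w, f w ∂p.measure = ∑ i, p.1.2 i • f (p.1.1 i) := by
  rw [measure, integral_finsetSum_measure]
  · refine Finset.sum_congr rfl fun i _ => ?_
    rw [integral_smul_measure, integral_dirac, ENNReal.toReal_ofReal (p.2.1.1 i)]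
  · intro i _
    exact (integrable_dirac (by simp)).smul_measure ENNReal.ofReal_ne_top

/-- The measure of a weighted triple, as a probability measure. -/
noncomputable def probabilityMeasure (p : WeightedTriple) : ProbabilityMeasure Circle :=
  ⟨p.measure, inferInstance⟩

/-- The measure of a weighted triple, as an element of `ThetaHat`. -/
noncomputable def toThetaHat (p : WeightedTriple) : ThetaHat :=
  ⟨p.probabilityMeasure, by
    classical
    refine ⟨?_, Finset.univ.image p.1.1, Finset.card_image_le.trans (by simp), ?_⟩
    · exact (p.integral_measure fun w => (w : ℂ)).trans (by simpa using p.2.2)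
    · simp [probabilityMeasure, measure, Measure.finsetSum_apply]⟩

theorem continuous_toThetaHat : Continuous toThetaHat := by
  have h : Continuous probabilityMeasure := by
    rw [ProbabilityMeasure.continuous_iff_forall_continuous_integral]
    intro f
    have : ∀ p : WeightedTriple, ∫ w, f w ∂(p.probabilityMeasure : Measure Circle) =
        ∑ i, p.1.2 i • f (p.1.1 i) := fun p => p.integral_measure f
    simp only [this]
    have h1 : Continuous fun p : WeightedTriple => p.1.1 := continuous_fst.comp continuous_subtype_val
    have h2 : Continuous fun p : WeightedTriple => p.1.2 := continuous_snd.comp continuous_subtype_val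
    refine continuous_finsetSum _ fun i _ => ?_
    exact ((continuous_apply i).comp h2).smul (f.continuous.comp ((continuous_apply i).comp h1))
  exact h.subtype_mk _

theorem surjective_toThetaHat : Function.Surjective toThetaHat := by
  rintro ⟨⟨μ, hμ⟩, hmean, s, hs, hsμ⟩
  have : Infinite Circle :=
    have := Set.Ioc.infinite (neg_lt_self Real.pi_pos)
    Infinite.of_injective _ Circle.argEquiv.symm.injective
  -- The support is padded to exactly three points; the added ones receive weight zero.
  obtain ⟨t, hst, ht⟩ := Infinite.exists_superset_card_eq s 3 hs
  have e : Fin 3 ≃ t := (Finset.equivFinOfCardEq ht).symm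
  have hinj : Function.Injective fun i => (e i : Circle) :=
    Subtype.val_injective.comp e.injective
  have htμ : μ (t : Set Circle)ᶜ = 0 :=
    measure_mono_null (Set.compl_subset_compl.2 (Finset.coe_subset.2 hst)) hsμ
  have hsum : μ = ∑ i, μ {(e i : Circle)} • Measure.dirac (e i : Circle) := by
    have h1 : (⋃ i, {(e i : Circle)}) = (t : Set Circle) := by
      ext w
      simp only [Set.mem_iUnion, Set.mem_singleton_iff, Finset.mem_coe]
      exact ⟨fun ⟨i, hi⟩ => hi ▸ (e i).2, fun hw => ⟨e.symm ⟨w, hw⟩, by simp⟩⟩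
    have h2 : μ.restrict (⋃ i, {(e i : Circle)}) = μ := by
      rw [h1]
      exact Measure.restrict_eq_self_of_ae_mem (ae_iff.2 htμ)
    have h3 := Measure.restrict_iUnion (μ := μ) (s := fun i => {(e i : Circle)})
      (fun i j hij => by simpa using hinj.ne hij) (fun i => measurableSet_singleton _)
    rw [h2, Measure.sum_fintype] at h3
    simpa only [Measure.restrict_singleton] using h3
  have hμ1 : ∑ i, μ.real {(e i : Circle)} = 1 := by
    have h1 := hμ.measure_univ
    rw [hsum] at h1
    simp only [Measure.coe_finsetSum, Finset.sum_apply, Measure.smul_apply, measure_univ,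
      smul_eq_mul, mul_one] at h1
    simp only [Measure.real]
    rw [← ENNReal.toReal_sum fun i _ => measure_ne_top _ _, h1, ENNReal.toReal_one]
  have hsum' : μ = ∑ i, ENNReal.ofReal (μ.real {(e i : Circle)}) • Measure.dirac (e i : Circle) := by
    simpa [Measure.real] using hsum
  have hint : ∑ i, (μ.real {(e i : Circle)} : ℂ) * (e i : Circle) = 0 := by
    have h1 : ∫ w : Circle, (w : ℂ) ∂μ = 0 := hmean
    rw [hsum, integral_finsetSum_measure] at h1
    · simpa [integral_smul_measure, Measure.real] using h1
    · intro i _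
      exact (integrable_dirac (by simp)).smul_measure (measure_ne_top _ _)
  refine ⟨⟨(fun i => e i, fun i => μ.real {(e i : Circle)}), ⟨fun i => measureReal_nonneg, hμ1⟩,
    hint⟩, ?_⟩
  apply Subtype.ext
  apply Subtype.ext
  exact hsum'.symm

/-- The sum of the three points. -/
noncomputable def sum (p : WeightedTriple) : ℂ := p.1.1 0 + p.1.1 1 + p.1.1 2

theorem continuous_sum : Continuous sum := by
  have h1 : Continuous fun p : WeightedTriple => p.1.1 := continuous_fst.comp continuous_subtype_val
  have h2 : ∀ i, Continuous fun p : WeightedTriple => (p.1.1 i : ℂ) := fun i =>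
    continuous_subtype_val.comp ((continuous_apply i).comp h1)
  exact ((h2 0).add (h2 1)).add (h2 2)

end WeightedTriple

/-! ### The functions `psi` in terms of Blaschke products -/

theorem re_add_div_sub (w : Circle) (z : ℂ) :
    (((w : ℂ) + z) / (w - z)).re = (1 - ‖z‖ ^ 2) / ‖(w : ℂ) - z‖ ^ 2 := by
  have h := w.normSq_coe
  rw [Complex.normSq_apply] at h
  rw [Complex.div_re, ← add_div, Complex.sq_norm, Complex.sq_norm, Complex.normSq_apply z]
  congr 1
  simp only [Complex.add_re, Complex.add_im, Complex.sub_re, Complex.sub_im]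
  linear_combination h

theorem coe_circle_sub_ne_zero (w : Circle) (z : 𝔻) : (w : ℂ) - z ≠ 0 := by
  intro h
  have h1 := w.norm_coe
  rw [sub_eq_zero.1 h] at h1
  exact z.norm_ne_one h1

namespace WeightedTriple

variable (p : WeightedTriple)

theorem herglotz_toThetaHat (z : 𝔻) : herglotz p.toThetaHat z =
    ∑ i, (p.1.2 i : ℂ) * (((p.1.1 i : ℂ) + z) / ((p.1.1 i : ℂ) - z)) := by
  refine (p.integral_measure fun w => ((w : ℂ) + z) / ((w : ℂ) - z)).trans ?_
  simp only [Complex.real_smul]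

theorem re_herglotz_toThetaHat (z : 𝔻) : (herglotz p.toThetaHat z).re =
    ∑ i, p.1.2 i * ((1 - ‖(z : ℂ)‖ ^ 2) / ‖(p.1.1 i : ℂ) - z‖ ^ 2) := by
  rw [herglotz_toThetaHat, Complex.re_sum]
  simp only [Complex.re_ofReal_mul, re_add_div_sub]

theorem re_herglotz_ge (z : 𝔻) (i : Fin 3) :
    p.1.2 i * ((1 - ‖(z : ℂ)‖ ^ 2) / ‖(p.1.1 i : ℂ) - z‖ ^ 2) ≤ (herglotz p.toThetaHat z).re := by
  rw [re_herglotz_toThetaHat]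
  refine Finset.single_le_sum (f := fun i =>
    p.1.2 i * ((1 - ‖(z : ℂ)‖ ^ 2) / ‖(p.1.1 i : ℂ) - z‖ ^ 2)) (fun j _ => ?_) (Finset.mem_univ i)
  exact mul_nonneg (p.2.1.1 j) (div_nonneg (sub_nonneg.2 z.sq_norm_lt_one.le) (sq_nonneg _))

theorem herglotz_add_one_ne_zero (z : 𝔻) : herglotz p.toThetaHat z + 1 ≠ 0 := by
  intro h
  have h1 := p.re_herglotz_ge z 0
  have h2 : 0 ≤ p.1.2 0 * ((1 - ‖(z : ℂ)‖ ^ 2) / ‖(p.1.1 0 : ℂ) - z‖ ^ 2) :=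
    mul_nonneg (p.2.1.1 0) (div_nonneg (sub_nonneg.2 z.sq_norm_lt_one.le) (sq_nonneg _))
  have h3 := congrArg Complex.re h
  simp at h3
  linarith

theorem sum_weights : (p.1.2 0 : ℂ) + p.1.2 1 + p.1.2 2 = 1 := by
  have h := p.2.1.2
  rw [Fin.sum_univ_three] at h
  exact_mod_cast h

theorem mean_eq_zero : (p.1.2 0 : ℂ) * p.1.1 0 + p.1.2 1 * p.1.1 1 + p.1.2 2 * p.1.1 2 = 0 := by
  have h := p.2.2
  rwa [Fin.sum_univ_three] at h

/-- The product of the three points. -/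
noncomputable def prod : ℂ := p.1.1 0 * p.1.1 1 * p.1.1 2

theorem norm_prod : ‖p.prod‖ = 1 := by
  simp only [prod, norm_mul, Circle.norm_coe, mul_one]

/-- Conjugate the mean-zero relation and multiply by the product of the points, using that
conjugation inverts points of the circle. -/
theorem sum_weights_mul_mul : (p.1.2 0 : ℂ) * (p.1.1 1 * p.1.1 2) + p.1.2 1 * (p.1.1 0 * p.1.1 2)
    + p.1.2 2 * (p.1.1 0 * p.1.1 1) = 0 := by
  have h := congrArg conj p.mean_eq_zero
  simp only [map_add, map_mul, Complex.conj_ofReal, map_zero] at h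
  have hw : ∀ i, (p.1.1 i : ℂ) * conj (p.1.1 i : ℂ) = 1 := fun i => by simp [Complex.mul_conj]
  linear_combination (p.1.1 0 * p.1.1 1 * p.1.1 2 : ℂ) * h - p.1.2 0 * (p.1.1 1 * p.1.1 2) * hw 0
    - p.1.2 1 * (p.1.1 0 * p.1.1 2) * hw 1 - p.1.2 2 * (p.1.1 0 * p.1.1 1) * hw 2

theorem prod_mul_conj_sum : p.prod * conj p.sum =
    p.1.1 1 * p.1.1 2 + p.1.1 0 * p.1.1 2 + p.1.1 0 * p.1.1 1 := by
  have hw : ∀ i, (p.1.1 i : ℂ) * conj (p.1.1 i : ℂ) = 1 := fun i => by simp [Complex.mul_conj]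
  simp only [sum, map_add, prod]
  linear_combination (p.1.1 1 * p.1.1 2 : ℂ) * hw 0 + (p.1.1 0 * p.1.1 2 : ℂ) * hw 1
    + (p.1.1 0 * p.1.1 1 : ℂ) * hw 2

/-- Total mass one, mean zero and the conjugate of the latter eliminate the weights, so only the
points remain. -/
theorem herglotz_sub_one (z : 𝔻) : herglotz p.toThetaHat z - 1 = 2 * (z ^ 2 * (z - p.sum)) /
    ((p.1.1 0 - z) * (p.1.1 1 - z) * (p.1.1 2 - z)) := by
  have h0 := coe_circle_sub_ne_zero (p.1.1 0) z
  have h1 := coe_circle_sub_ne_zero (p.1.1 1) z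
  have h2 := coe_circle_sub_ne_zero (p.1.1 2) z
  rw [herglotz_toThetaHat, Fin.sum_univ_three, eq_div_iff (mul_ne_zero (mul_ne_zero h0 h1) h2)]
  have k0 := div_mul_cancel₀ ((p.1.1 0 : ℂ) + z) h0
  have k1 := div_mul_cancel₀ ((p.1.1 1 : ℂ) + z) h1
  have k2 := div_mul_cancel₀ ((p.1.1 2 : ℂ) + z) h2
  simp only [sum]
  linear_combination p.1.2 0 * ((p.1.1 1 - z) * (p.1.1 2 - z)) * k0
    + p.1.2 1 * ((p.1.1 0 - z) * (p.1.1 2 - z)) * k1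
    + p.1.2 2 * ((p.1.1 0 - z) * (p.1.1 1 - z)) * k2
    + ((p.1.1 0 - z) * (p.1.1 1 - z) * (p.1.1 2 - z)
      + 2 * z ^ 2 * (z - (p.1.1 0 + p.1.1 1 + p.1.1 2))) * p.sum_weights
    + 2 * z * p.sum_weights_mul_mul + 2 * (z : ℂ) ^ 2 * p.mean_eq_zero

theorem herglotz_add_one (z : 𝔻) : herglotz p.toThetaHat z + 1 =
    2 * (p.prod * (1 - conj p.sum * z)) /
    ((p.1.1 0 - z) * (p.1.1 1 - z) * (p.1.1 2 - z)) := by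
  have h0 := coe_circle_sub_ne_zero (p.1.1 0) z
  have h1 := coe_circle_sub_ne_zero (p.1.1 1) z
  have h2 := coe_circle_sub_ne_zero (p.1.1 2) z
  rw [herglotz_toThetaHat, Fin.sum_univ_three, eq_div_iff (mul_ne_zero (mul_ne_zero h0 h1) h2)]
  have k0 := div_mul_cancel₀ ((p.1.1 0 : ℂ) + z) h0
  have k1 := div_mul_cancel₀ ((p.1.1 1 : ℂ) + z) h1
  have k2 := div_mul_cancel₀ ((p.1.1 2 : ℂ) + z) h2
  have hP := p.prod_mul_conj_sum
  simp only [prod] at hP ⊢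
  linear_combination p.1.2 0 * ((p.1.1 1 - z) * (p.1.1 2 - z)) * k0
    + p.1.2 1 * ((p.1.1 0 - z) * (p.1.1 2 - z)) * k1
    + p.1.2 2 * ((p.1.1 0 - z) * (p.1.1 1 - z)) * k2
    + (2 * (p.1.1 0 * p.1.1 1 * p.1.1 2)
      - 2 * z * (p.1.1 1 * p.1.1 2 + p.1.1 0 * p.1.1 2 + p.1.1 0 * p.1.1 1)
      - (p.1.1 0 - z) * (p.1.1 1 - z) * (p.1.1 2 - z)) * p.sum_weights
    + 2 * z * p.sum_weights_mul_mul + 2 * (z : ℂ) ^ 2 * p.mean_eq_zero + 2 * z * hP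

/-- Otherwise `1 / conj p.sum` would be a point of the disc at which `h + 1` vanishes, although `h`
has nonnegative real part. -/
theorem norm_sum_le_one : ‖p.sum‖ ≤ 1 := by
  by_contra! h
  have h0 : p.sum ≠ 0 := norm_pos_iff.1 (one_pos.trans h)
  have hz : ‖(conj p.sum)⁻¹‖ < 1 := by
    rw [norm_inv, Complex.norm_conj]
    exact inv_lt_one_of_one_lt₀ h
  apply p.herglotz_add_one_ne_zero (.mk _ hz)
  rw [herglotz_add_one]
  simp [h0]

/-- `psi` of a weighted triple is, up to a unimodular factor, the Blaschke product with a double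
zero at `0` and a zero at the sum of the three points. -/
theorem psi_toThetaHat (z : 𝔻) : psi p.toThetaHat z = p.prod⁻¹ * blaschke p.sum z := by
  have h0 := coe_circle_sub_ne_zero (p.1.1 0) z
  have h1 := coe_circle_sub_ne_zero (p.1.1 1) z
  have h2 := coe_circle_sub_ne_zero (p.1.1 2) z
  rw [psi, herglotz_sub_one, herglotz_add_one,
    div_div_div_cancel_right₀ (mul_ne_zero (mul_ne_zero h0 h1) h2),
    mul_div_mul_left _ _ two_ne_zero, blaschke, mul_comm p.prod, ← div_div, div_eq_inv_mul _ p.prod]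

/-- Mass at `-1` forces `Re h` to blow up along the radius to `-1`, so `psi` tends to `1` there.
This radial limit fixes the unimodular constant in `psi_eq_of_equiv`. -/
theorem norm_one_sub_psi_le {i : Fin 3} (hi : p.1.1 i = -1) (hp : 0 < p.1.2 i) {r : ℝ}
    (hr0 : 0 < r) (hr1 : r < 1) (z : 𝔻) (hz : (z : ℂ) = -(r : ℂ)) :
    ‖1 - psi p.toThetaHat z‖ ≤ 2 * (1 - r) / p.1.2 i := by
  have hne := p.herglotz_add_one_ne_zero z
  have h1 : 1 - psi p.toThetaHat z = 2 / (herglotz p.toThetaHat z + 1) := by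
    rw [psi, eq_div_iff hne, sub_mul, div_mul_cancel₀ _ hne]
    ring
  have h2 := p.re_herglotz_ge z i
  have h3 : ‖(p.1.1 i : ℂ) - z‖ = 1 - r := by
    rw [hi, hz]
    have : ((-1 : Circle) : ℂ) - -(r : ℂ) = ((-(1 - r) : ℝ) : ℂ) := by
      push_cast
      ring
    rw [this, Complex.norm_real, norm_neg, Real.norm_eq_abs, abs_of_pos (by linarith)]
  have h4 : ‖(z : ℂ)‖ = r := by
    rw [hz, norm_neg, Complex.norm_real, Real.norm_eq_abs, abs_of_pos hr0]
  rw [h3, h4] at h2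
  have h5 : 1 / (1 - r) ≤ (1 - r ^ 2) / (1 - r) ^ 2 := by
    have : 0 < 1 - r := by linarith
    rw [div_le_div_iff₀ this (by positivity)]
    nlinarith [mul_pos this this]
  have h6 : p.1.2 i / (1 - r) ≤ ‖herglotz p.toThetaHat z + 1‖ := by
    have h7 := Complex.re_le_norm (herglotz p.toThetaHat z + 1)
    have h8 := mul_le_mul_of_nonneg_left h5 hp.le
    rw [mul_one_div] at h8
    simp only [Complex.add_re, Complex.one_re] at h7
    linarith
  have h7 : 0 < p.1.2 i / (1 - r) := div_pos hp (by linarith)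
  rw [h1, norm_div, Complex.norm_ofNat]
  calc 2 / ‖herglotz p.toThetaHat z + 1‖ ≤ 2 / (p.1.2 i / (1 - r)) := by gcongr
    _ = 2 * (1 - r) / p.1.2 i := by rw [div_div_eq_mul_div]

theorem exists_eq_neg_one (h : 0 < (p.toThetaHat.1 : Measure Circle) {-1}) :
    ∃ i, p.1.1 i = -1 ∧ 0 < p.1.2 i := by
  by_contra! hc
  refine h.ne' ?_
  change p.measure {-1} = 0
  simp only [measure, Measure.coe_finsetSum, Finset.sum_apply, Measure.smul_apply, smul_eq_mul]
  refine Finset.sum_eq_zero fun i _ => ?_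
  rcases eq_or_ne (p.1.1 i) (-1) with hi | hi
  · rw [ENNReal.ofReal_of_nonpos (hc i hi), zero_mul]
  · simp [hi]

end WeightedTriple

/-- Two equivalent measures with mass at `-1` have the same function `psi`. -/
theorem psi_eq_of_equiv {μ ν : ThetaHat} (h : thetaSetoid.r μ ν)
    (hμ : 0 < (μ.1 : Measure Circle) {-1}) (hν : 0 < (ν.1 : Measure Circle) {-1}) :
    psi μ = psi ν := by
  obtain ⟨p, rfl⟩ := WeightedTriple.surjective_toThetaHat μ
  obtain ⟨q, rfl⟩ := WeightedTriple.surjective_toThetaHat ν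
  obtain ⟨i, hi, hpi⟩ := p.exists_eq_neg_one hμ
  obtain ⟨j, hj, hqj⟩ := q.exists_eq_neg_one hν
  obtain ⟨c, hc, h⟩ := h
  have key : ∀ r ∈ Set.Ioo (0 : ℝ) 1,
      ‖1 - c‖ ≤ 2 * (1 - r) / p.1.2 i + 2 * (1 - r) / q.1.2 j := by
    intro r hr
    have hz : ‖(-(r : ℂ))‖ < 1 := by simpa [abs_of_pos hr.1] using hr.2
    have h1 := p.norm_one_sub_psi_le hi hpi hr.1 hr.2 (.mk _ hz) rfl
    have h2 := q.norm_one_sub_psi_le hj hqj hr.1 hr.2 (.mk _ hz) rfl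
    have h3 : 1 - c = (1 - psi p.toThetaHat (.mk _ hz)) - c * (1 - psi q.toThetaHat (.mk _ hz)) := by
      rw [h]
      ring
    rw [h3]
    refine (norm_sub_le _ _).trans ?_
    rw [norm_mul, hc, one_mul]
    exact add_le_add h1 h2
  have hlim : Filter.Tendsto (fun r : ℝ => 2 * (1 - r) / p.1.2 i + 2 * (1 - r) / q.1.2 j)
      (𝓝[<] 1) (𝓝 0) := by
    have : Continuous fun r : ℝ => 2 * (1 - r) / p.1.2 i + 2 * (1 - r) / q.1.2 j := by fun_prop
    have h1 := this.tendsto 1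
    simp only [sub_self, mul_zero, zero_div, add_zero] at h1
    exact h1.mono_left nhdsWithin_le_nhds
  have h0 : ‖1 - c‖ ≤ 0 := by
    refine ge_of_tendsto hlim ?_
    filter_upwards [Ioo_mem_nhdsLT (zero_lt_one' ℝ)] with r hr using key r hr
  have hc1 : c = 1 := (sub_eq_zero.1 (norm_le_zero_iff.1 h0)).symm
  funext z
  rw [h, hc1, one_mul]

/-! ### Separation of a function of `Psi` from a closed subset -/

theorem thetaSetoid_of_eqOn {μ ν : ThetaHat} {c d : ℂ} (hc : ‖c‖ = 1) (hd : ‖d‖ = 1) {f : 𝔻 → ℂ}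
    (hμ : ∀ z, psi μ z = c * f z) (hν : ∀ z, psi ν z = d * f z) : thetaSetoid.r μ ν := by
  have hd0 : d ≠ 0 := norm_ne_zero_iff.1 (by rw [hd]; exact one_ne_zero)
  refine ⟨c * d⁻¹, by simp [hc, hd], fun z => ?_⟩
  rw [hμ, hν, mul_assoc, inv_mul_cancel_left₀ hd0]

namespace WeightedTriple

theorem norm_inv_prod (p : WeightedTriple) : ‖p.prod⁻¹‖ = 1 := by
  rw [norm_inv, norm_prod, inv_one]

/-- The class of the measure of a triple is determined by the sum of its points, and all the
triples whose sum is unimodular belong to one class. -/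
theorem equiv_of_sum (p q : WeightedTriple) (h : p.sum = q.sum ∨ (‖p.sum‖ = 1 ∧ ‖q.sum‖ = 1)) :
    thetaSetoid.r p.toThetaHat q.toThetaHat := by
  rcases h with h | ⟨hp, hq⟩
  · refine thetaSetoid_of_eqOn p.norm_inv_prod q.norm_inv_prod (f := fun z => blaschke q.sum z)
      (fun z => ?_) q.psi_toThetaHat
    rw [psi_toThetaHat, h]
  · refine thetaSetoid_of_eqOn (c := p.prod⁻¹ * -p.sum) (d := q.prod⁻¹ * -q.sum)
      (f := fun z => (z : ℂ) ^ 2) ?_ ?_ (fun z => ?_) (fun z => ?_)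
    · rw [norm_mul, norm_inv_prod, norm_neg, hp, one_mul]
    · rw [norm_mul, norm_inv_prod, norm_neg, hq, one_mul]
    · rw [psi_toThetaHat, blaschke_of_norm_eq_one hp z.norm_lt_one, mul_assoc]
    · rw [psi_toThetaHat, blaschke_of_norm_eq_one hq z.norm_lt_one, mul_assoc]

theorem norm_psi_lt_one (p : WeightedTriple) (z : 𝔻) : ‖psi p.toThetaHat z‖ < 1 := by
  rw [psi_toThetaHat, norm_mul, norm_inv_prod, one_mul]
  exact norm_blaschke_lt_one p.norm_sum_le_one z.norm_lt_one

theorem pick_psi (p : WeightedTriple) (x y : 𝔻) :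
    pick (psi p.toThetaHat x) (psi p.toThetaHat y) = pick (blaschke p.sum x) (blaschke p.sum y) := by
  rw [psi_toThetaHat, psi_toThetaHat, pick_mul_left p.norm_inv_prod]

theorem psi_mem_HOneInfty (p : WeightedTriple) : psi p.toThetaHat ∈ HOneInfty := by
  refine ⟨⟨fun z => p.prod⁻¹ * blaschke p.sum z, ?_, ?_, p.psi_toThetaHat⟩, 1,
    fun z => (p.norm_psi_lt_one z).le⟩
  · intro z hz
    have hd := one_sub_conj_mul_ne_zero p.norm_sum_le_one (mem_ball_zero_iff.1 hz)
    unfold blaschke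
    exact DifferentiableAt.differentiableWithinAt (by fun_prop (disch := exact hd))
  · have h1 : DifferentiableAt ℂ (fun z : ℂ => p.prod⁻¹ * ((z - p.sum) / (1 - conj p.sum * z))) 0 := by
      have hd : 1 - conj p.sum * 0 ≠ 0 := by simp
      fun_prop (disch := exact hd)
    have h2 := (((hasDerivAt_id (0 : ℂ)).pow 2).mul h1.hasDerivAt).deriv
    convert h2 using 1
    · congr 1
      funext z
      simp only [blaschke, Pi.mul_apply, Pi.pow_apply, id_eq]
      ring
    · simp

end WeightedTriple

theorem continuousOn_blaschke {x : ℂ} (hx : ‖x‖ < 1) :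
    ContinuousOn (fun b => blaschke b x) (Metric.closedBall 0 1) := by
  unfold blaschke
  refine ContinuousOn.div (by fun_prop) ?_ fun b hb =>
    one_sub_conj_mul_ne_zero (mem_closedBall_zero_iff.1 hb) hx
  exact (continuous_const.sub (Complex.continuous_conj.mul continuous_const)).continuousOn

theorem continuousOn_pick_blaschke {x y : ℂ} (hx : ‖x‖ < 1) (hy : ‖y‖ < 1) :
    ContinuousOn (fun b => pick (blaschke b x) (blaschke b y)) (Metric.closedBall 0 1) := by
  have h1 := continuousOn_blaschke hx
  have h2 := continuousOn_blaschke hy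
  have h3 : ContinuousOn (fun b => conj (blaschke b y)) (Metric.closedBall 0 1) :=
    Complex.continuous_conj.comp_continuousOn h2
  unfold pick
  refine ContinuousOn.div ((continuousOn_const.sub (h1.norm.pow 2)).mul
    (continuousOn_const.sub (h2.norm.pow 2)))
    ((continuousOn_const.sub (h1.mul h3)).norm.pow 2) fun b hb => ?_
  have hb' := mem_closedBall_zero_iff.1 hb
  have := one_sub_conj_mul_ne_zero (norm_blaschke_lt_one hb' hy).le (norm_blaschke_lt_one hb' hx)
  rw [mul_comm] at this
  exact pow_ne_zero 2 (norm_ne_zero_iff.2 this)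

/-- The Pick quotient separates a parameter from a compact set of inequivalent parameters. -/
theorem exists_pick_lt_sq_le {a : ℂ} (ha : ‖a‖ ≤ 1) {S : Set ℂ} (hS : IsCompact S)
    (hS1 : ∀ b ∈ S, ‖b‖ ≤ 1) (hSa : ∀ b ∈ S, b ≠ a ∧ (‖b‖ < 1 ∨ ‖a‖ < 1)) :
    ∃ (x y : 𝔻) (m : ℝ), x ≠ y ∧ m ^ 2 ≤ 1 ∧ pick (blaschke a x) (blaschke a y) < m ^ 2 ∧
      ∀ b ∈ S, m ^ 2 ≤ pick (blaschke b x) (blaschke b y) := by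
  obtain ⟨x, y, hx, hy, hxy, h⟩ := exists_forall_pick_lt ha
  -- `S` may be empty; adjoining one inequivalent parameter `b'` guarantees that the minimum exists
  -- and is still strictly above the value at `a`.
  obtain ⟨b', hb1, hb2⟩ : ∃ b' : ℂ, ‖b'‖ ≤ 1 ∧ b' ≠ a ∧ (‖b'‖ < 1 ∨ ‖a‖ < 1) := by
    rcases eq_or_ne a 0 with rfl | h0
    · exact ⟨1, by simp, by simp, by simp⟩
    · exact ⟨0, by simp, h0.symm, by simp⟩
  have hT1 : ∀ b ∈ insert b' S, ‖b‖ ≤ 1 := by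
    rintro b (rfl | hb)
    exacts [hb1, hS1 b hb]
  have hT2 : ∀ b ∈ insert b' S, b ≠ a ∧ (‖b‖ < 1 ∨ ‖a‖ < 1) := by
    rintro b (rfl | hb)
    exacts [hb2, hSa b hb]
  obtain ⟨b, hb, hmin⟩ := (hS.insert b').exists_isMinOn (Set.insert_nonempty b' S)
    ((continuousOn_pick_blaschke hx hy).mono fun b hb => mem_closedBall_zero_iff.2 (hT1 b hb))
  have hbx := norm_blaschke_lt_one (hT1 b hb) hx
  have hby := norm_blaschke_lt_one (hT1 b hb) hy
  refine ⟨.mk x hx, .mk y hy, √(pick (blaschke b x) (blaschke b y)), by simpa using hxy, ?_⟩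
  rw [Real.sq_sqrt (pick_nonneg hbx hby)]
  exact ⟨pick_le_one hbx hby, h b (hT1 b hb) (hT2 b hb).1 (hT2 b hb).2,
    fun d hd => hmin (Set.mem_insert_of_mem _ hd)⟩

end TestFunctions

/-! ### Proof of the theorem -/

open TestFunctions
theorem mainTheorem2 (C : Set (𝔻 → ℂ)) (hC : IsClosedInPsi C) (hne : C ≠ Psi) :
    ¬ IsTestFamilyForHOneInfty C := by
  rintro ⟨-, hH, hnorm⟩
  obtain ⟨f, ⟨μ, hμ, rfl⟩, hfC⟩ := Set.exists_of_ssubset (hC.1.ssubset_of_ne hne)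
  obtain ⟨p, rfl⟩ := WeightedTriple.surjective_toThetaHat μ
  have hclosed : IsClosed {q : WeightedTriple | Quotient.mk thetaSetoid q.toThetaHat ∈ params C} :=
    hC.2.preimage (continuous_quotient_mk'.comp WeightedTriple.continuous_toThetaHat)
  have hS := hclosed.isCompact.image WeightedTriple.continuous_sum
  -- A class in `params C` has a representative with mass at `-1` whose function is in `C`. If the
  -- class were that of `p`, this function would be `psi p.toThetaHat`, which is not in `C`.
  have hp : ∀ q : WeightedTriple, Quotient.mk thetaSetoid q.toThetaHat ∈ params C →
      ¬ thetaSetoid.r q.toThetaHat p.toThetaHat := by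
    rintro q ⟨ν, hν, hν1, hνC⟩ hqp
    have h := thetaSetoid.trans (Quotient.exact hν) hqp
    exact hfC (psi_eq_of_equiv h hν1 hμ ▸ hνC)
  obtain ⟨x, y, m, hxy, hm, hlt, hle⟩ := exists_pick_lt_sq_le p.norm_sum_le_one hS
    (by rintro _ ⟨q, -, rfl⟩; exact q.norm_sum_le_one)
    (by
      rintro _ ⟨q, hq, rfl⟩
      refine ⟨fun h => hp q hq (q.equiv_of_sum p (.inl h)), ?_⟩
      by_contra! h
      exact hp q hq (q.equiv_of_sum p
        (.inr ⟨q.norm_sum_le_one.antisymm h.1, p.norm_sum_le_one.antisymm h.2⟩)))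
  have hf := p.psi_mem_HOneInfty
  have hf1 : HInftyNorm (kernels C) (psi p.toThetaHat) ≤ 1 := by
    rw [hnorm _ hf]
    exact ciSup_le fun z => (p.norm_psi_lt_one z).le
  have h := sq_le_pick_of_norm_le_one hxy hm (Ψ := C) ?_ (hH ▸ hf) hf1 (p.norm_psi_lt_one x)
    (p.norm_psi_lt_one y)
  · rw [p.pick_psi] at h
    exact hlt.not_ge h
  · intro ψ hψ
    obtain ⟨ν, hν, rfl⟩ := hC.1 hψ
    obtain ⟨q, rfl⟩ := WeightedTriple.surjective_toThetaHat ν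
    refine ⟨q.norm_psi_lt_one x, q.norm_psi_lt_one y, ?_⟩
    rw [q.pick_psi]
    exact hle _ ⟨q, ⟨q.toThetaHat, rfl, hν, hψ⟩, rfl⟩
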